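/- Let $k \ge 1$ and let $(\sigma_1,\dots,\sigma_k)$ be the coordinates on $\mathbb{C}^k$. For $\sigma \in \mathbb{C}^k$ put $P_\sigma(z) := z^k + \sum_{h=1}^k (-1)^h \sigma_h z^{k-h}$, and let $z_1,\dots,z_k$ be the roots of $P_\sigma$, counted with multiplicity. For an entire function $f$ on $\mathbb{C}$, the trace function of $f$ is the function on $\mathbb{C}^k$ given by $T(f)(\sigma) := \sum_{j=1}^k f(z_j)$. Write $\partial_h := \partial/\partial\sigma_h$, let $E := \sum_{h=1}^k \sigma_h \partial_h$ be the Euler field, and put $T^m := \partial_1\partial_{m-1} + \partial_m E$ for $2 \le m \le k$, where $\partial_m E$ is the composition of operators. Let $(S\,0)$ be the system of equations $T^m F = 0$ for all $m \in [2,k]$ (an empty system if $k = 1$). 1. A function $F : \mathbb{C}^k \to \mathbb{C}$ is a global holomorphic solution of $(S\,0)$ on $\mathbb{C}^k$ if and only if $F = T(f)$ for some entire function $f$ on $\mathbb{C}$. 2. A global holomorphic solution of $(S\,0)$ is determined by its derivative $\partial_1 F$ up to an additive constant. Precisely, if $G$ is a global holomorphic solution of $(S\,0)$, then the global holomorphic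 solutions $F$ of $(S\,0)$ with $\partial_1 F = \partial_1 G$ are exactly the functions $F = G + c$ with $c \in \mathbb{C}$. -/

import Mathlib

/-- The monic polynomial `P_σ(z) = z^k + ∑_{h=1}^k (-1)^h σ_h z^{k-h}` attached to
`σ = (σ_1, …, σ_k) ∈ ℂ^k`.  The coordinate `σ_h` is `σ i` with `h = i + 1`. -/
noncomputable def rootPoly {k : ℕ} (σ : Fin k → ℂ) : Polynomial ℂ :=
  Polynomial.X ^ k +
    ∑ i : Fin k, Polynomial.C ((-1) ^ (i.val + 1) * σ i) * Polynomial.X ^ (k - (i.val + 1))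

/-- The trace function `T(f)(σ) = ∑_j f(z_j)`, the sum being over the roots `z_1, …, z_k` of `P_σ`
counted with multiplicity. -/
noncomputable def traceFunction (k : ℕ) (f : ℂ → ℂ) (σ : Fin k → ℂ) : ℂ :=
  ((rootPoly σ).roots.map f).sum

/-- The vector of `ℂ^k` in the direction of the coordinate `σ_h`, for `1 ≤ h ≤ k`. -/
def coordVec (k h : ℕ) : Fin k → ℂ := fun i => if i.val + 1 = h then 1 else 0

/-- The partial derivative `∂_h F = ∂F/∂σ_h`, for `1 ≤ h ≤ k`. -/
noncomputable def partialD {k : ℕ} (h : ℕ) (F : (Fin k → ℂ) → ℂ) (σ : Fin k → ℂ) : ℂ :=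
  fderiv ℂ F σ (coordVec k h)

/-- The Euler field `E = ∑_{h=1}^k σ_h ∂_h`. -/
noncomputable def eulerField {k : ℕ} (F : (Fin k → ℂ) → ℂ) (σ : Fin k → ℂ) : ℂ :=
  ∑ i : Fin k, σ i * partialD (i.val + 1) F σ

/-- The operator `T^m = ∂_1 ∂_{m-1} + ∂_m E`, for `2 ≤ m ≤ k`. -/
noncomputable def opT {k : ℕ} (m : ℕ) (F : (Fin k → ℂ) → ℂ) (σ : Fin k → ℂ) : ℂ :=
  partialD 1 (partialD (m - 1) F) σ + partialD m (eulerField F) σ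

/-- `F` is a global holomorphic solution on `ℂ^k` of the system
`T^m F = 0` for all `m ∈ [2, k]`. -/
def IsGlobalSolution {k : ℕ} (F : (Fin k → ℂ) → ℂ) : Prop :=
  Differentiable ℂ F ∧ ∀ m : ℕ, 2 ≤ m → m ≤ k → ∀ σ : Fin k → ℂ, opT m F σ = 0

open MeasureTheory Metric Set Filter Topology

section

variable {k : ℕ}

/-! Write `L_z` for the linear part of `σ ↦ P_σ(z)`, so that `P_σ(z) = z^k + L_z(σ)`.

Traces are solutions: by the residue theorem, `T(f)` is `(2πi)⁻¹ ∮ f P'/P` over a large circle.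
Differentiating in `σ` and integrating by parts in `z` gives `∂_v T(f) = -(2πi)⁻¹ ∮ f' L_z(v)/P`
(`hasFDerivAt_traceFunction`). As `L_z(σ) = P - z^k` and `∮ f' = 0`, it follows that `E T(f) =
(2πi)⁻¹ ∮ f' z^k/P`. One more derivative turns both terms of `T^m` into integrals of `± f'
z^(2k-m)/P²` with opposite signs.

Uniqueness: `[∂_v, E] = ∂_v`, so each derivative of a solution solves the system with `E` replaced
by `E + r`. At the origin `E` vanishes and the equation reads `(1 + r) ∂_m F(0) = -∂_1 ∂_{m-1}
F(0)`. By induction the pure `σ_1`-derivatives at `0` determine all the others, hence the entire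
function `F` (`IsGlobalSolution.eq_zero`).

Conversely, on the `σ_1`-axis the roots are `t, 0, …, 0`, so `f` can be chosen to make `T(f)` agree
with `F` there; uniqueness gives `F = T(f)`. Part 2 is uniqueness applied to `F - G` minus its value
at `0`. -/

/-! ### Differentiation under interval and circle integrals -/

theorem hasFDerivAt_intervalIntegral_of_continuousOn {V E : Type*} [NormedAddCommGroup V]
    [NormedSpace ℂ V] [ProperSpace V] [NormedAddCommGroup E] [NormedSpace ℂ E]
    {U : Set V} (hU : IsOpen U) {K : V → ℝ → E} {K' : V → ℝ → V →L[ℂ] E} {a b : ℝ}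
    (hK : ContinuousOn (Function.uncurry K) (U ×ˢ univ))
    (hK' : ContinuousOn (Function.uncurry K') (U ×ˢ univ))
    (hd : ∀ x ∈ U, ∀ t, HasFDerivAt (fun y => K y t) (K' x t) x) {x : V} (hx : x ∈ U) :
    HasFDerivAt (fun y => ∫ t in a..b, K y t) (∫ t in a..b, K' x t) x := by
  have slice : ∀ y ∈ U, Continuous (K y) := fun y hy =>
    continuousOn_univ.1 (hK.comp (f := fun t => (y, t)) (by fun_prop) (fun t _ => ⟨hy, mem_univ _⟩))
  have slice' : ∀ y ∈ U, Continuous (K' y) := fun y hy =>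
    continuousOn_univ.1 (hK'.comp (f := fun t => (y, t)) (by fun_prop) (fun t _ => ⟨hy, mem_univ _⟩))
  obtain ⟨r, hr, hrU⟩ := Metric.nhds_basis_closedBall.mem_iff.1 (hU.mem_nhds hx)
  obtain ⟨C, hC⟩ := ((isCompact_closedBall x r).prod (isCompact_uIcc (a := a) (b := b))).exists_bound_of_continuousOn
    (hK'.mono (prod_mono hrU (subset_univ _)))
  refine intervalIntegral.hasFDerivAt_integral_of_dominated_of_fderiv_le
    (closedBall_mem_nhds x hr) (bound := fun _ => C) ?_ ((slice x hx).intervalIntegrable _ _)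
    (slice' x hx).aestronglyMeasurable ?_ intervalIntegrable_const ?_
  · filter_upwards [hU.mem_nhds hx] with y hy using (slice y hy).aestronglyMeasurable
  · exact .of_forall fun t ht y hy => hC (y, t) ⟨hy, uIoc_subset_uIcc ht⟩
  · exact .of_forall fun t _ y hy => hd y (hrU hy) t

theorem hasFDerivAt_circleIntegral_of_continuousOn {V E : Type*} [NormedAddCommGroup V]
    [NormedSpace ℂ V] [ProperSpace V] [NormedAddCommGroup E] [NormedSpace ℂ E]
    {U : Set V} (hU : IsOpen U) {K : V → ℂ → E} {K' : V → ℂ → V →L[ℂ] E} {c : ℂ} {R : ℝ}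
    (hR : 0 ≤ R)
    (hK : ContinuousOn (Function.uncurry K) (U ×ˢ sphere c R))
    (hK' : ContinuousOn (Function.uncurry K') (U ×ˢ sphere c R))
    (hd : ∀ x ∈ U, ∀ z ∈ sphere c R, HasFDerivAt (fun y => K y z) (K' x z) x) {x : V}
    (hx : x ∈ U) :
    HasFDerivAt (fun y => ∮ z in C(c, R), K y z) (∮ z in C(c, R), K' x z) x := by
  have hm : MapsTo (fun p : V × ℝ => (p.1, circleMap c R p.2)) (U ×ˢ univ) (U ×ˢ sphere c R) :=
    fun p hp => ⟨hp.1, circleMap_mem_sphere c hR p.2⟩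
  have hc : ContinuousOn (fun p : V × ℝ => (p.1, circleMap c R p.2)) (U ×ˢ univ) := by fun_prop
  have hc' : ContinuousOn (fun p : V × ℝ => circleMap 0 R p.2 * Complex.I) (U ×ˢ univ) := by
    fun_prop
  simp only [circleIntegral, deriv_circleMap]
  refine hasFDerivAt_intervalIntegral_of_continuousOn hU
    (K := fun y t => (circleMap 0 R t * Complex.I) • K y (circleMap c R t))
    (K' := fun y t => (circleMap 0 R t * Complex.I) • K' y (circleMap c R t))
    (hc'.smul (hK.comp hc hm)) (hc'.smul (hK'.comp hc hm)) (fun y hy t => ?_) hx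
  exact (hd y hy _ (circleMap_mem_sphere c hR t)).const_smul _

theorem circleIntegral_clm_apply {V E : Type*} [NormedAddCommGroup V] [NormedSpace ℂ V]
    [NormedAddCommGroup E] [NormedSpace ℂ E] {K : ℂ → V →L[ℂ] E} {c : ℂ} {R : ℝ}
    (hK : CircleIntegrable K c R) (v : V) :
    (∮ z in C(c, R), K z) v = ∮ z in C(c, R), K z v := by
  simp only [circleIntegral]
  rw [ContinuousLinearMap.intervalIntegral_apply hK.out]
  rfl

/-! ### Entire functions of several variables: regularity and symmetry of derivatives -/

section Entire

variable {V : Type*} [NormedAddCommGroup V] [NormedSpace ℂ V]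

theorem hasDerivAt_comp_line {F : V → ℂ} (hF : Differentiable ℂ F) (x v : V) (t : ℂ) :
    HasDerivAt (fun s : ℂ => F (x + s • v)) (fderiv ℂ F (x + t • v) v) t := by
  have h : HasDerivAt (fun s : ℂ => x + s • v) v t := by
    simpa using ((hasDerivAt_id t).smul_const v).const_add x
  exact (hF _).hasFDerivAt.comp_hasDerivAt t h

/-- Cauchy's formula for the first derivative on the complex line through `x` in direction `v`. The
integrand involves only values of `F`, so regularity of `F` passes to its derivative. -/
theorem fderiv_apply_eq_circleIntegral {F : V → ℂ} (hF : Differentiable ℂ F) (x v : V) :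
    fderiv ℂ F x v = (2 * Real.pi * Complex.I : ℂ)⁻¹ *
      ∮ z in C(0, 1), (z ^ 2)⁻¹ * F (x + z • v) := by
  have hd : Differentiable ℂ (fun s : ℂ => F (x + s • v)) := fun t =>
    (hasDerivAt_comp_line hF x v t).differentiableAt
  have h := (hd.diffContOnCl (s := ball 0 1)).circleIntegral_one_div_sub_center_pow_smul one_pos 1
  rw [iteratedDeriv_one, (hasDerivAt_comp_line hF x v 0).deriv] at h
  simp only [sub_zero, Nat.reduceAdd, one_div, smul_eq_mul, Nat.factorial_one, Nat.cast_one,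
    div_one, zero_smul, add_zero] at h
  rw [h, inv_mul_cancel_left₀ (by simp [Real.pi_ne_zero])]

variable [FiniteDimensional ℂ V]

/-- Comes before differentiability of the derivative: differentiating Cauchy's formula under the
integral needs a continuous `fderiv`. -/
theorem continuous_fderiv_of_differentiable {F : V → ℂ} (hF : Differentiable ℂ F) :
    Continuous (fderiv ℂ F) := by
  rw [continuous_clm_apply]
  intro v
  simp only [fderiv_apply_eq_circleIntegral hF _ v, circleIntegral, deriv_circleMap]
  have hc := hF.continuous
  refine continuous_const.mul
    (intervalIntegral.continuous_parametric_intervalIntegral_of_continuous'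
      (μ := volume) (f := fun x t => (circleMap 0 1 t * Complex.I) •
        ((circleMap 0 1 t ^ 2)⁻¹ * F (x + circleMap 0 1 t • v))) ?_ _ _)
  have h1 : Continuous fun p : V × ℝ => (circleMap 0 1 p.2 ^ 2)⁻¹ :=
    Continuous.inv₀ (by fun_prop) fun p => by simp
  simp only [Function.uncurry_def]
  fun_prop

theorem differentiable_fderiv_apply {F : V → ℂ} (hF : Differentiable ℂ F) (v : V) :
    Differentiable ℂ fun x => fderiv ℂ F x v := by
  have : ProperSpace V := FiniteDimensional.proper ℂ V
  intro x
  simp only [fderiv_apply_eq_circleIntegral hF _ v]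
  have hz : ContinuousOn (fun p : V × ℂ => (p.2 ^ 2)⁻¹) (univ ×ˢ sphere 0 1) := by
    refine ContinuousOn.inv₀ (by fun_prop) fun p hp => ?_
    have := hp.2
    simp only [mem_sphere, dist_zero_right] at this
    exact pow_ne_zero _ (norm_ne_zero_iff.1 (by simp [this]))
  have hc := hF.continuous
  have hc' := continuous_fderiv_of_differentiable hF
  have h := (hasFDerivAt_circleIntegral_of_continuousOn isOpen_univ zero_le_one
    (K := fun y z => (z ^ 2)⁻¹ * F (y + z • v))
    (K' := fun y z => (z ^ 2)⁻¹ • fderiv ℂ F (y + z • v))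
    (hz.mul (by fun_prop)) (hz.smul (by fun_prop)) ?_ (mem_univ x)).differentiableAt
  · exact h.const_mul _
  intro y _ z _
  exact ((hasFDerivAt_comp_add_right (z • v)).2 (hF _).hasFDerivAt).const_mul _

theorem differentiable_fderiv_of_differentiable {F : V → ℂ} (hF : Differentiable ℂ F) :
    Differentiable ℂ (fderiv ℂ F) :=
  ContDiff.differentiable (n := 1) (contDiff_clm_apply_iff.2 fun v =>
    contDiff_one_iff_fderiv.2 ⟨differentiable_fderiv_apply hF v,
      continuous_fderiv_of_differentiable (differentiable_fderiv_apply hF v)⟩) one_ne_zero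

theorem fderiv_fderiv_apply_comm {F : V → ℂ} (hF : Differentiable ℂ F) (x v w : V) :
    fderiv ℂ (fun y => fderiv ℂ F y v) x w = fderiv ℂ (fun y => fderiv ℂ F y w) x v := by
  have h := (differentiable_fderiv_of_differentiable hF x).hasFDerivAt
  have key (u : V) : fderiv ℂ (fun y => fderiv ℂ F y u) x =
      (fderiv ℂ (fderiv ℂ F) x).flip u := by
    have := h.clm_apply (hasFDerivAt_const u x)
    simpa using this.fderiv
  rw [key, key]
  exact second_derivative_symmetric (fun y => (hF y).hasFDerivAt) h w v

end Entire

/-! ### Calculus of directional derivatives and the Euler field -/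

/-- The derivative of `F` in the direction of the fixed vector `v`. -/
noncomputable def directionalD (v : Fin k → ℂ) (F : (Fin k → ℂ) → ℂ) (σ : Fin k → ℂ) : ℂ :=
  fderiv ℂ F σ v

theorem partialD_eq_directionalD (h : ℕ) :
    partialD (k := k) h = directionalD (coordVec k h) := rfl

theorem differentiable_directionalD {F : (Fin k → ℂ) → ℂ} (hF : Differentiable ℂ F)
    (v : Fin k → ℂ) : Differentiable ℂ (directionalD v F) :=
  differentiable_fderiv_apply hF v

theorem differentiable_iterate_directionalD {F : (Fin k → ℂ) → ℂ} (hF : Differentiable ℂ F)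
    (v : Fin k → ℂ) (n : ℕ) : Differentiable ℂ ((directionalD v)^[n] F) := by
  induction n generalizing F with
  | zero => exact hF
  | succ n ih => exact ih (differentiable_directionalD hF v)

theorem directionalD_comm {F : (Fin k → ℂ) → ℂ} (hF : Differentiable ℂ F) (v w : Fin k → ℂ) :
    directionalD v (directionalD w F) = directionalD w (directionalD v F) :=
  funext fun σ => fderiv_fderiv_apply_comm hF σ w v

theorem iterate_directionalD_comm {F : (Fin k → ℂ) → ℂ} (hF : Differentiable ℂ F)
    (v w : Fin k → ℂ) (n : ℕ) :
    (directionalD v)^[n] (directionalD w F) = directionalD w ((directionalD v)^[n] F) := by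
  induction n generalizing F with
  | zero => rfl
  | succ n ih =>
    rw [Function.iterate_succ_apply, Function.iterate_succ_apply, directionalD_comm hF,
      ih (differentiable_directionalD hF v)]

theorem directionalD_add {F G : (Fin k → ℂ) → ℂ} (hF : Differentiable ℂ F)
    (hG : Differentiable ℂ G) (v : Fin k → ℂ) :
    directionalD v (F + G) = directionalD v F + directionalD v G :=
  funext fun σ => by simp [directionalD, fderiv_add (hF σ) (hG σ)]

theorem directionalD_sub {F G : (Fin k → ℂ) → ℂ} (hF : Differentiable ℂ F)
    (hG : Differentiable ℂ G) (v : Fin k → ℂ) :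
    directionalD v (F - G) = directionalD v F - directionalD v G :=
  funext fun σ => by simp [directionalD, fderiv_sub (hF σ) (hG σ)]

theorem directionalD_smul {F : (Fin k → ℂ) → ℂ} (hF : Differentiable ℂ F) (c : ℂ)
    (v : Fin k → ℂ) : directionalD v (c • F) = c • directionalD v F :=
  funext fun σ => by simp [directionalD, fderiv_const_smul (hF σ)]

theorem directionalD_const (c : ℂ) (v : Fin k → ℂ) : directionalD v (fun _ => c) = 0 :=
  funext fun σ => by simp [directionalD]

theorem sum_smul_coordVec (v : Fin k → ℂ) :
    ∑ i : Fin k, v i • coordVec k (i.val + 1) = v := by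
  ext j
  simp [coordVec, Fin.val_inj]

theorem sum_mul_partialD (F : (Fin k → ℂ) → ℂ) (v σ : Fin k → ℂ) :
    ∑ i : Fin k, v i * partialD (i.val + 1) F σ = directionalD v F σ := by
  conv_rhs => rw [directionalD, ← sum_smul_coordVec v]
  simp [partialD]

theorem eulerField_eq_fderiv (F : (Fin k → ℂ) → ℂ) :
    eulerField F = fun σ => fderiv ℂ F σ σ :=
  funext fun σ => sum_mul_partialD F σ σ

theorem differentiable_eulerField {F : (Fin k → ℂ) → ℂ} (hF : Differentiable ℂ F) :
    Differentiable ℂ (eulerField F) := by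
  rw [eulerField_eq_fderiv]
  exact (differentiable_fderiv_of_differentiable hF).clm_apply differentiable_id

/-- The commutator `[∂_v, E] = ∂_v`: the extra term comes from differentiating the coefficients of
`E`, and the rest is symmetry of the second derivative. -/
theorem directionalD_eulerField {F : (Fin k → ℂ) → ℂ} (hF : Differentiable ℂ F)
    (v : Fin k → ℂ) :
    directionalD v (eulerField F) = directionalD v F + eulerField (directionalD v F) := by
  ext σ
  have h := (differentiable_fderiv_of_differentiable hF σ).hasFDerivAt
  have h1 := (h.clm_apply (hasFDerivAt_id σ)).fderiv
  have h2 := (h.clm_apply (hasFDerivAt_const v σ)).fderiv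
  have hs := second_derivative_symmetric (fun y => (hF y).hasFDerivAt) h v σ
  simp only [eulerField_eq_fderiv, Pi.add_apply]
  simp only [id] at h1
  unfold directionalD
  rw [h1, h2]
  simp [hs]

/-! ### Shifted systems and uniqueness -/

/-- Entire functions annihilated by all the operators `∂_1 ∂_{m-1} + ∂_m (E + r)`. -/
def IsShiftedSolution (r : ℕ) (F : (Fin k → ℂ) → ℂ) : Prop :=
  Differentiable ℂ F ∧ ∀ m : ℕ, 2 ≤ m → m ≤ k → opT m F + (r : ℂ) • partialD m F = 0

theorem isShiftedSolution_zero_iff {F : (Fin k → ℂ) → ℂ} :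
    IsShiftedSolution 0 F ↔ IsGlobalSolution F := by
  simp [IsShiftedSolution, IsGlobalSolution, funext_iff]

theorem opT_eq (m : ℕ) (F : (Fin k → ℂ) → ℂ) :
    opT m F = directionalD (coordVec k 1) (directionalD (coordVec k (m - 1)) F) +
      directionalD (coordVec k m) (eulerField F) := rfl

theorem opT_sub {F G : (Fin k → ℂ) → ℂ} (hF : Differentiable ℂ F)
    (hG : Differentiable ℂ G) (m : ℕ) : opT m (F - G) = opT m F - opT m G := by
  have hE : eulerField (F - G) = eulerField F - eulerField G := by
    ext σ
    simp [eulerField_eq_fderiv, fderiv_sub (hF σ) (hG σ)]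
  rw [opT_eq, opT_eq, opT_eq, hE, directionalD_sub hF hG,
    directionalD_sub (differentiable_directionalD hF _) (differentiable_directionalD hG _),
    directionalD_sub (differentiable_eulerField hF) (differentiable_eulerField hG)]
  abel

theorem IsGlobalSolution.sub {F G : (Fin k → ℂ) → ℂ} (hF : IsGlobalSolution F)
    (hG : IsGlobalSolution G) : IsGlobalSolution (F - G) :=
  ⟨hF.1.sub hG.1, fun m h2 hm σ => by
    simp [opT_sub hF.1 hG.1, hF.2 m h2 hm σ, hG.2 m h2 hm σ]⟩

theorem isGlobalSolution_const (c : ℂ) : IsGlobalSolution (fun _ : Fin k → ℂ => c) := by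
  refine ⟨differentiable_const c, fun m _ _ σ => ?_⟩
  have hE : eulerField (fun _ : Fin k → ℂ => c) = fun _ => 0 := by
    ext σ
    simp [eulerField_eq_fderiv]
  rw [opT_eq, hE, directionalD_const, directionalD_const]
  simp [directionalD]

/-- Moving `∂_v` past `E` leaves one extra `∂_m ∂_v F`, which raises the shift by one. -/
theorem IsShiftedSolution.directionalD {r : ℕ} {F : (Fin k → ℂ) → ℂ}
    (hF : IsShiftedSolution r F) (v : Fin k → ℂ) :
    IsShiftedSolution (r + 1) (directionalD v F) := by
  refine ⟨differentiable_directionalD hF.1 v, fun m h2 hm => ?_⟩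
  have h := congrArg (_root_.directionalD v) (hF.2 m h2 hm)
  have d := hF.1
  have dd (w : Fin k → ℂ) := differentiable_directionalD d w
  have ddd (w u : Fin k → ℂ) := differentiable_directionalD (dd w) u
  have dE := differentiable_eulerField d
  have dE' := differentiable_eulerField (dd v)
  rw [opT_eq, partialD_eq_directionalD, directionalD_add ((ddd _ _).add
    (differentiable_directionalD dE _)) ((dd _).const_smul _),
    directionalD_add (ddd _ _) (differentiable_directionalD dE _),
    directionalD_smul (dd _), directionalD_comm (dd _), directionalD_comm d v (coordVec k (m - 1)),
    directionalD_comm dE, directionalD_eulerField d v, directionalD_add (dd v) dE',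
    directionalD_comm d v] at h
  have h0 : _root_.directionalD v (0 : (Fin k → ℂ) → ℂ) = 0 := directionalD_const 0 v
  rw [h0] at h
  rw [opT_eq, partialD_eq_directionalD, ← h]
  push_cast
  module

theorem IsShiftedSolution.iterate_directionalD {r : ℕ} {F : (Fin k → ℂ) → ℂ}
    (hF : IsShiftedSolution r F) (v : Fin k → ℂ) (n : ℕ) :
    IsShiftedSolution (r + n) ((_root_.directionalD v)^[n] F) := by
  induction n with
  | zero => exact hF
  | succ n ih =>
    rw [Function.iterate_succ_apply']
    exact ih.directionalD v

/-- At the origin the Euler term drops out, so the equation expresses `∂_m ∂_1^n F(0)` through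
`∂_{m-1} ∂_1^(n+1) F(0)`. Induction on `m` ends at pure `∂_1`-derivatives. -/
theorem IsShiftedSolution.partialD_iterate_apply_zero {r : ℕ} {F : (Fin k → ℂ) → ℂ}
    (hF : IsShiftedSolution r F) (h0 : ∀ n, (_root_.directionalD (coordVec k 1))^[n] F 0 = 0)
    {m : ℕ} (h1 : 1 ≤ m) :
    m ≤ k → ∀ n, partialD m ((_root_.directionalD (coordVec k 1))^[n] F) 0 = 0 := by
  induction m, h1 using Nat.le_induction with
  | base =>
    intro _ n
    rw [partialD_eq_directionalD, ← Function.iterate_succ_apply' (_root_.directionalD (coordVec k 1))]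
    exact h0 (n + 1)
  | succ m h1 ih =>
    intro hm n
    have hS := hF.iterate_directionalD (coordVec k 1) n
    have h := congrFun (hS.2 (m + 1) (by omega) hm) 0
    have hprev := ih (by omega) (n + 1)
    rw [Function.iterate_succ_apply', partialD_eq_directionalD, ← directionalD_comm hS.1] at hprev
    rw [opT_eq, directionalD_eulerField hS.1] at h
    have hE (G : (Fin k → ℂ) → ℂ) : eulerField G 0 = 0 := by simp [eulerField]
    simp only [Nat.add_sub_cancel, Pi.add_apply, hprev, hE, Pi.smul_apply, Pi.zero_apply,
      partialD_eq_directionalD, smul_eq_mul, zero_add, add_zero] at h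
    rw [← one_add_mul] at h
    refine (mul_eq_zero.1 h).resolve_left ?_
    -- The `1` comes from the commutator and `r + n` from the shift after `n` derivatives.
    exact_mod_cast (by omega : 1 + (r + n) ≠ 0)

theorem IsShiftedSolution.iterate_directionalD_apply_zero {r : ℕ} {F : (Fin k → ℂ) → ℂ}
    (hF : IsShiftedSolution r F) (h0 : ∀ n, (_root_.directionalD (coordVec k 1))^[n] F 0 = 0)
    (v : Fin k → ℂ) (n : ℕ) : (_root_.directionalD v)^[n] F 0 = 0 := by
  induction n generalizing r F with
  | zero => exact h0 0
  | succ n ih =>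
    -- The shift must vary in the induction: `∂_v F` has shift `r + 1`, and its `∂_1`-derivatives at
    -- `0` vanish by expanding `v` in coordinates.
    refine ih (hF.directionalD v) fun j => ?_
    rw [iterate_directionalD_comm hF.1, ← sum_mul_partialD]
    refine Finset.sum_eq_zero fun i _ => ?_
    rw [hF.partialD_iterate_apply_zero h0 (by omega) (by omega), mul_zero]

theorem iteratedDeriv_comp_smul {F : (Fin k → ℂ) → ℂ} (hF : Differentiable ℂ F)
    (v : Fin k → ℂ) (n : ℕ) :
    iteratedDeriv n (fun t : ℂ => F (t • v)) = fun t => (directionalD v)^[n] F (t • v) := by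
  induction n with
  | zero => simp
  | succ n ih =>
    ext t
    rw [iteratedDeriv_succ, ih, Function.iterate_succ_apply']
    simpa [directionalD] using
      (hasDerivAt_comp_line (differentiable_iterate_directionalD hF v n) 0 v t).deriv

/-- The one-variable Taylor series on each complex line through the origin suffices; no
multivariable expansion is needed. -/
theorem eq_zero_of_iterate_directionalD_eq_zero {F : (Fin k → ℂ) → ℂ} (hF : Differentiable ℂ F)
    (h : ∀ v n, (directionalD v)^[n] F 0 = 0) : F = 0 := by
  ext v
  have hd : Differentiable ℂ (fun t : ℂ => F (t • v)) := by fun_prop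
  have := Complex.taylorSeries_eq_of_entire hd 0 1
  simpa [iteratedDeriv_comp_smul hF, h] using this.symm

/-- A global solution is determined by its derivatives of all orders along the `σ_1` direction
at the origin. -/
theorem IsGlobalSolution.eq_zero {F : (Fin k → ℂ) → ℂ} (hF : IsGlobalSolution F)
    (h0 : ∀ n, (partialD 1)^[n] F 0 = 0) : F = 0 :=
  eq_zero_of_iterate_directionalD_eq_zero hF.1
    ((isShiftedSolution_zero_iff.2 hF).iterate_directionalD_apply_zero h0)

/-! ### The polynomial `P_σ(z)` as a function of `σ` and `z` -/

/-- The linear part of `σ ↦ P_σ(z)`. -/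
noncomputable def evalForm (k : ℕ) (z : ℂ) : (Fin k → ℂ) →L[ℂ] ℂ :=
  ∑ i : Fin k, ((-1) ^ (i.val + 1) * z ^ (k - (i.val + 1))) •
    ContinuousLinearMap.proj (R := ℂ) (φ := fun _ : Fin k => ℂ) i

/-- The derivative of `evalForm` with respect to `z`. -/
noncomputable def evalDerivForm (k : ℕ) (z : ℂ) : (Fin k → ℂ) →L[ℂ] ℂ :=
  ∑ i : Fin k, ((-1) ^ (i.val + 1) * ((k - (i.val + 1) : ℕ) * z ^ (k - (i.val + 1) - 1))) •
    ContinuousLinearMap.proj (R := ℂ) (φ := fun _ : Fin k => ℂ) i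

theorem evalForm_apply (z : ℂ) (σ : Fin k → ℂ) :
    evalForm k z σ = ∑ i : Fin k, ((-1) ^ (i.val + 1) * z ^ (k - (i.val + 1))) * σ i := by
  simp [evalForm]

theorem evalDerivForm_apply (z : ℂ) (σ : Fin k → ℂ) :
    evalDerivForm k z σ = ∑ i : Fin k,
      ((-1) ^ (i.val + 1) * ((k - (i.val + 1) : ℕ) * z ^ (k - (i.val + 1) - 1))) * σ i := by
  simp [evalDerivForm]

theorem continuous_evalForm : Continuous (evalForm k) := by
  unfold evalForm
  fun_prop

theorem continuous_evalDerivForm : Continuous (evalDerivForm k) := by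
  unfold evalDerivForm
  fun_prop

theorem hasDerivAt_evalForm_apply (v : Fin k → ℂ) (z : ℂ) :
    HasDerivAt (fun w => evalForm k w v) (evalDerivForm k z v) z := by
  simp only [evalForm_apply, evalDerivForm_apply]
  exact HasDerivAt.fun_sum fun i _ => ((hasDerivAt_pow _ z).const_mul _).mul_const _

theorem eval_rootPoly (σ : Fin k → ℂ) (z : ℂ) :
    (rootPoly σ).eval z = z ^ k + evalForm k z σ := by
  simp only [rootPoly, evalForm_apply, Polynomial.eval_add, Polynomial.eval_pow, Polynomial.eval_X,
    Polynomial.eval_finsetSum, Polynomial.eval_mul, Polynomial.eval_C]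
  congr 1
  exact Finset.sum_congr rfl fun i _ => by ring

theorem eval_derivative_rootPoly (σ : Fin k → ℂ) (z : ℂ) :
    (rootPoly σ).derivative.eval z = k * z ^ (k - 1) + evalDerivForm k z σ := by
  simp only [rootPoly, evalDerivForm_apply, Polynomial.derivative_add, Polynomial.derivative_X_pow,
    Polynomial.derivative_sum, Polynomial.derivative_C_mul, Polynomial.eval_add,
    Polynomial.eval_pow, Polynomial.eval_X, Polynomial.eval_finsetSum, Polynomial.eval_mul,
    Polynomial.eval_C]
  congr 1
  exact Finset.sum_congr rfl fun i _ => by ring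

theorem hasDerivAt_eval_rootPoly (σ : Fin k → ℂ) (z : ℂ) :
    HasDerivAt (fun w => w ^ k + evalForm k w σ) (k * z ^ (k - 1) + evalDerivForm k z σ) z :=
  (hasDerivAt_pow k z).add (hasDerivAt_evalForm_apply σ z)

theorem evalForm_coordVec {h : ℕ} (h1 : 1 ≤ h) (hk : h ≤ k) (z : ℂ) :
    evalForm k z (coordVec k h) = (-1) ^ h * z ^ (k - h) := by
  rw [evalForm_apply, Finset.sum_eq_single ⟨h - 1, by omega⟩]
  · simp [coordVec, Nat.sub_add_cancel h1]
  · intro i _ hi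
    have : i.val + 1 ≠ h := fun e => hi (Fin.ext (by simp; omega))
    simp [coordVec, this]
  · simp

/-- For `‖z‖ ≥ 1` the `k` lower terms total at most `k M ‖z‖^(k-1)`, which is below `‖z‖^k` once
`‖z‖ > k M`. Hence one circle of radius `k M + 1` serves every `σ` in the ball. -/
theorem eval_rootPoly_ne_zero {M : ℝ} {σ : Fin k → ℂ} (hσ : σ ∈ ball (0 : Fin k → ℂ) M)
    {z : ℂ} (hz : k * M + 1 ≤ ‖z‖) : z ^ k + evalForm k z σ ≠ 0 := by
  have hσM : ‖σ‖ < M := by simpa using hσ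
  have hM : 0 < M := (norm_nonneg _).trans_lt hσM
  have hz1 : 1 ≤ ‖z‖ := le_trans (by have : 0 ≤ k * M := by positivity
                                     linarith) hz
  intro h0
  have hle : ‖evalForm k z σ‖ ≤ k * (‖z‖ ^ (k - 1) * M) := by
    rw [evalForm_apply]
    refine (norm_sum_le _ _).trans ?_
    refine (Finset.sum_le_card_nsmul _ _ (‖z‖ ^ (k - 1) * M) fun i _ => ?_).trans (by simp)
    rw [norm_mul, norm_mul, norm_pow, norm_pow, norm_neg, norm_one, one_pow, one_mul]
    exact mul_le_mul (pow_le_pow_right₀ hz1 (by omega)) ((norm_le_pi_norm σ i).trans hσM.le)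
      (norm_nonneg _) (by positivity)
  have heq : ‖evalForm k z σ‖ = ‖z‖ ^ k := by
    rw [eq_neg_of_add_eq_zero_right h0, norm_neg, norm_pow]
  rcases Nat.eq_zero_or_pos k with rfl | hk
  · simp [evalForm_apply] at h0
  · rw [heq] at hle
    have hpos : 0 < ‖z‖ ^ (k - 1) := by positivity
    have : ‖z‖ ^ k = ‖z‖ ^ (k - 1) * ‖z‖ := by rw [← pow_succ, Nat.sub_add_cancel hk]
    nlinarith

/-! ### Integral representation of the trace -/

theorem integral_sum_inv_sub_mul {f : ℂ → ℂ} (hf : Differentiable ℂ f) {R : ℝ} (hR : 0 < R)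
    (s : Multiset ℂ) (hs : ∀ w ∈ s, w ∈ ball (0 : ℂ) R) :
    CircleIntegrable (fun z => f z * (s.map fun w => 1 / (z - w)).sum) 0 R ∧
    (∮ z in C(0, R), f z * (s.map fun w => 1 / (z - w)).sum) =
      2 * Real.pi * Complex.I * (s.map f).sum := by
  induction s using Multiset.induction_on with
  | empty => simp [circleIntegral]
  | cons a s ih =>
    obtain ⟨h1, h2⟩ := ih fun w hw => hs w (Multiset.mem_cons_of_mem hw)
    have ha := hs a (Multiset.mem_cons_self a s)
    have hi : CircleIntegrable (fun z => (z - a)⁻¹ * f z) 0 R := by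
      refine ContinuousOn.circleIntegrable hR.le (ContinuousOn.mul ?_ hf.continuous.continuousOn)
      refine ContinuousOn.inv₀ (by fun_prop) fun z hz => ?_
      rw [sub_ne_zero]
      rintro rfl
      rw [mem_sphere] at hz
      rw [mem_ball] at ha
      linarith
    have hc := (hf.differentiableOn (s := closedBall 0 R)).circleIntegral_sub_inv_smul ha
    simp only [smul_eq_mul] at hc
    have e : (fun z => f z * ((a ::ₘ s).map fun w => 1 / (z - w)).sum) =
        fun z => (z - a)⁻¹ * f z + f z * (s.map fun w => 1 / (z - w)).sum := by
      ext z
      rw [Multiset.map_cons, Multiset.sum_cons]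
      ring
    rw [e]
    refine ⟨hi.add h1, ?_⟩
    rw [circleIntegral.integral_add hi h1, hc, h2, Multiset.map_cons, Multiset.sum_cons]
    ring

theorem rootPoly_ne_zero (σ : Fin k → ℂ) : rootPoly σ ≠ 0 := by
  intro h
  obtain ⟨M, hM⟩ := exists_gt ‖σ‖
  have hM0 : 0 < M := (norm_nonneg _).trans_lt hM
  have := eval_rootPoly_ne_zero (z := ((k * M + 1 : ℝ) : ℂ)) (by simpa using hM)
    (by rw [Complex.norm_real, Real.norm_of_nonneg (by positivity)])
  rw [← eval_rootPoly, h] at this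
  simp at this

/-- The logarithmic derivative `P'/P` is the sum of `1/(z - w)` over the roots with multiplicity;
Cauchy's formula applies to each term. -/
theorem traceFunction_eq_circleIntegral {f : ℂ → ℂ} (hf : Differentiable ℂ f) {M : ℝ} (hM : 0 < M)
    {σ : Fin k → ℂ} (hσ : σ ∈ ball (0 : Fin k → ℂ) M) :
    traceFunction k f σ = (2 * Real.pi * Complex.I : ℂ)⁻¹ *
      ∮ z in C(0, k * M + 1), f z *
        ((k * z ^ (k - 1) + evalDerivForm k z σ) / (z ^ k + evalForm k z σ)) := by
  have hR : 0 < k * M + 1 := by positivity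
  have h := (integral_sum_inv_sub_mul hf hR (rootPoly σ).roots fun w hw => ?_).2
  · have e : (∮ z in C(0, k * M + 1), f z *
        ((k * z ^ (k - 1) + evalDerivForm k z σ) / (z ^ k + evalForm k z σ))) =
        ∮ z in C(0, k * M + 1), f z * ((rootPoly σ).roots.map fun w => 1 / (z - w)).sum := by
      refine circleIntegral.integral_congr hR.le fun z hz => ?_
      have hz' := eval_rootPoly_ne_zero hσ (z := z) (by simpa using (mem_sphere_zero_iff_norm.1 hz).ge)
      rw [← eval_rootPoly] at hz'
      rw [← (IsAlgClosed.splits (rootPoly σ)).eval_derivative_div_eval_of_ne_zero hz',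
        eval_rootPoly, eval_derivative_rootPoly]
    rw [e, h, inv_mul_cancel_left₀ (by simp [Real.pi_ne_zero])]
    rfl
  · rw [Polynomial.mem_roots (rootPoly_ne_zero σ), Polynomial.IsRoot, eval_rootPoly] at hw
    rw [mem_ball_zero_iff]
    by_contra! hle
    exact eval_rootPoly_ne_zero hσ hle hw

theorem continuous_eval_rootPoly :
    Continuous fun p : (Fin k → ℂ) × ℂ => p.2 ^ k + evalForm k p.2 p.1 :=
  (continuous_snd.pow k).add ((continuous_evalForm.comp continuous_snd).clm_apply continuous_fst)

theorem continuous_eval_derivative_rootPoly :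
    Continuous fun p : (Fin k → ℂ) × ℂ => k * p.2 ^ (k - 1) + evalDerivForm k p.2 p.1 :=
  (continuous_const.mul (continuous_snd.pow _)).add
    ((continuous_evalDerivForm.comp continuous_snd).clm_apply continuous_fst)

theorem eval_rootPoly_ne_zero_of_mem {M : ℝ} {p : (Fin k → ℂ) × ℂ}
    (hp : p ∈ ball (0 : Fin k → ℂ) M ×ˢ sphere (0 : ℂ) (k * M + 1)) :
    p.2 ^ k + evalForm k p.2 p.1 ≠ 0 :=
  eval_rootPoly_ne_zero hp.1 (mem_sphere_zero_iff_norm.1 hp.2).ge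

theorem hasFDerivAt_eval_rootPoly (z : ℂ) (σ : Fin k → ℂ) :
    HasFDerivAt (fun τ => z ^ k + evalForm k z τ) (evalForm k z) σ :=
  (evalForm k z).hasFDerivAt.const_add _

theorem hasFDerivAt_eval_derivative_rootPoly (z : ℂ) (σ : Fin k → ℂ) :
    HasFDerivAt (fun τ => k * z ^ (k - 1) + evalDerivForm k z τ) (evalDerivForm k z) σ :=
  (evalDerivForm k z).hasFDerivAt.const_add _

/-! ### Derivatives of the trace; trace functions solve the system -/

/-- The function `σ ↦ (2πi)⁻¹ ∮ g(z) / P_σ(z) dz`, on the circle of radius `k M + 1`. -/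
noncomputable def residueSum (k : ℕ) (M : ℝ) (g : ℂ → ℂ) (σ : Fin k → ℂ) : ℂ :=
  (2 * Real.pi * Complex.I : ℂ)⁻¹ * ∮ z in C(0, k * M + 1), g z * (z ^ k + evalForm k z σ)⁻¹

theorem directionalD_residueSum {g : ℂ → ℂ} (hg : Continuous g) {M : ℝ} (hM : 0 < M)
    {σ : Fin k → ℂ} (hσ : σ ∈ ball (0 : Fin k → ℂ) M) (v : Fin k → ℂ) :
    directionalD v (residueSum k M g) σ = (2 * Real.pi * Complex.I : ℂ)⁻¹ *
      ∮ z in C(0, k * M + 1), -(g z * evalForm k z v * ((z ^ k + evalForm k z σ) ^ 2)⁻¹) := by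
  have hR : 0 ≤ k * M + 1 := by positivity
  have hne := fun p hp => eval_rootPoly_ne_zero_of_mem (k := k) (M := M) (p := p) hp
  have hc := (continuous_eval_rootPoly (k := k)).continuousOn
    (s := ball (0 : Fin k → ℂ) M ×ˢ sphere (0 : ℂ) (k * M + 1))
  have hgc : ContinuousOn (fun p : (Fin k → ℂ) × ℂ => g p.2)
    (ball (0 : Fin k → ℂ) M ×ˢ sphere (0 : ℂ) (k * M + 1)) := by fun_prop
  have hLc : ContinuousOn (fun p : (Fin k → ℂ) × ℂ => evalForm k p.2)
    (ball (0 : Fin k → ℂ) M ×ˢ sphere (0 : ℂ) (k * M + 1)) :=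
    (continuous_evalForm.comp continuous_snd).continuousOn
  have hK' : ContinuousOn (Function.uncurry fun (τ : Fin k → ℂ) z =>
      g z • -((z ^ k + evalForm k z τ) ^ 2)⁻¹ • evalForm k z)
      (ball (0 : Fin k → ℂ) M ×ˢ sphere (0 : ℂ) (k * M + 1)) :=
    hgc.smul (((hc.pow 2).inv₀ fun p hp => pow_ne_zero 2 (hne p hp)).neg.smul hLc)
  have h := (hasFDerivAt_circleIntegral_of_continuousOn isOpen_ball hR
    (K := fun τ z => g z * (z ^ k + evalForm k z τ)⁻¹) (hgc.mul (hc.inv₀ hne)) hK'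
    (fun τ hτ z hz => ((hasDerivAt_inv (hne (τ, z) ⟨hτ, hz⟩)).comp_hasFDerivAt τ
      (hasFDerivAt_eval_rootPoly z τ)).const_mul (g z)) hσ).const_mul (2 * Real.pi * Complex.I : ℂ)⁻¹
  have hi : CircleIntegrable (fun z => g z • -((z ^ k + evalForm k z σ) ^ 2)⁻¹ • evalForm k z)
      0 (k * M + 1) := by
    refine ContinuousOn.circleIntegrable hR ?_
    exact hK'.comp (f := fun z => (σ, z)) (by fun_prop) fun z hz => ⟨hσ, hz⟩
  unfold directionalD residueSum
  rw [h.fderiv, smul_apply, circleIntegral_clm_apply hi, smul_eq_mul]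
  congr 2
  ext z
  simp
  ring

/-- Integration by parts: `f q` is a primitive along a closed curve, so there is no boundary term.
-/
theorem circleIntegral_mul_deriv {f q : ℂ → ℂ} {q' : ℂ → ℂ} (hf : Differentiable ℂ f) {R : ℝ}
    (hR : 0 ≤ R) (hq : ∀ z ∈ sphere (0 : ℂ) R, HasDerivAt q (q' z) z)
    (hq' : ContinuousOn q' (sphere (0 : ℂ) R)) :
    (∮ z in C(0, R), f z * q' z) = -∮ z in C(0, R), deriv f z * q z := by
  have h := circleIntegral.integral_eq_zero_of_hasDerivWithinAt hR fun z hz =>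
    ((hf z).hasDerivAt.mul (hq z hz)).hasDerivWithinAt (s := sphere 0 R)
  have hf' : Continuous (deriv f) := hf.contDiff.continuous_deriv (n := 1) le_rfl
  rw [circleIntegral.integral_add] at h
  · rw [eq_neg_iff_add_eq_zero, add_comm, h]
  · exact (hf'.continuousOn.mul fun z hz =>
      (hq z hz).continuousAt.continuousWithinAt).circleIntegrable hR
  · exact (hf.continuous.continuousOn.mul hq').circleIntegrable hR

/-- The `σ`-derivative of `P'/P` along `v` equals the `z`-derivative of `L_z(v)/P`: both are the
mixed derivative of `log P`. Integration by parts then moves the `z`-derivative onto `f`. -/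
theorem hasFDerivAt_traceFunction {f : ℂ → ℂ} (hf : Differentiable ℂ f) {M : ℝ} (hM : 0 < M)
    {σ : Fin k → ℂ} (hσ : σ ∈ ball (0 : Fin k → ℂ) M) :
    DifferentiableAt ℂ (traceFunction k f) σ ∧ ∀ v, directionalD v (traceFunction k f) σ =
      -residueSum k M (fun z => deriv f z * evalForm k z v) σ := by
  have hR : 0 ≤ k * M + 1 := by positivity
  have hne := fun p hp => eval_rootPoly_ne_zero_of_mem (k := k) (M := M) (p := p) hp
  have hc := (continuous_eval_rootPoly (k := k)).continuousOn
    (s := ball (0 : Fin k → ℂ) M ×ˢ sphere (0 : ℂ) (k * M + 1))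
  have hcd := (continuous_eval_derivative_rootPoly (k := k)).continuousOn
    (s := ball (0 : Fin k → ℂ) M ×ˢ sphere (0 : ℂ) (k * M + 1))
  have hfc := hf.continuous
  have hgc : ContinuousOn (fun p : (Fin k → ℂ) × ℂ => f p.2)
    (ball (0 : Fin k → ℂ) M ×ˢ sphere (0 : ℂ) (k * M + 1)) := by fun_prop
  have hLc : ContinuousOn (fun p : (Fin k → ℂ) × ℂ => evalForm k p.2)
    (ball (0 : Fin k → ℂ) M ×ˢ sphere (0 : ℂ) (k * M + 1)) :=
    (continuous_evalForm.comp continuous_snd).continuousOn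
  have hLdc : ContinuousOn (fun p : (Fin k → ℂ) × ℂ => evalDerivForm k p.2)
    (ball (0 : Fin k → ℂ) M ×ˢ sphere (0 : ℂ) (k * M + 1)) :=
    (continuous_evalDerivForm.comp continuous_snd).continuousOn
  set K' : (Fin k → ℂ) → ℂ → ((Fin k → ℂ) →L[ℂ] ℂ) := fun τ z =>
    f z • ((z ^ k + evalForm k z τ) ^ 2)⁻¹ • ((z ^ k + evalForm k z τ) • evalDerivForm k z -
      (k * z ^ (k - 1) + evalDerivForm k z τ) • evalForm k z) with hK'def
  have hK' : ContinuousOn (Function.uncurry K')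
      (ball (0 : Fin k → ℂ) M ×ˢ sphere (0 : ℂ) (k * M + 1)) :=
    hgc.smul (((hc.pow 2).inv₀ fun p hp => pow_ne_zero 2 (hne p hp)).smul
      ((hc.smul hLdc).sub (hcd.smul hLc)))
  have hslice : ContinuousOn (K' σ) (sphere (0 : ℂ) (k * M + 1)) :=
    hK'.comp (f := fun z => (σ, z)) (by fun_prop) fun z hz => ⟨hσ, hz⟩
  have h := (hasFDerivAt_circleIntegral_of_continuousOn isOpen_ball hR
    (K := fun τ z => f z * ((k * z ^ (k - 1) + evalDerivForm k z τ) / (z ^ k + evalForm k z τ)))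
    (hgc.mul (hcd.div hc hne)) hK'
    (fun τ hτ z hz => by
      have hz0 : z ^ k + evalForm k z τ ≠ 0 := hne (τ, z) ⟨hτ, hz⟩
      have h1 := ((hasFDerivAt_eval_derivative_rootPoly z τ).mul ((hasDerivAt_inv hz0).comp_hasFDerivAt
        τ (hasFDerivAt_eval_rootPoly z τ))).const_mul (f z)
      refine h1.congr_fderiv ?_
      ext v
      simp only [hK'def, smul_apply, sub_apply, add_apply, smul_eq_mul, Function.comp_apply]
      field_simp
      ring) hσ).const_mul (2 * Real.pi * Complex.I : ℂ)⁻¹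
  have heq : traceFunction k f =ᶠ[𝓝 σ] fun τ => (2 * Real.pi * Complex.I : ℂ)⁻¹ *
      ∮ z in C(0, k * M + 1), f z *
        ((k * z ^ (k - 1) + evalDerivForm k z τ) / (z ^ k + evalForm k z τ)) := by
    filter_upwards [isOpen_ball.mem_nhds hσ] with τ hτ
      using traceFunction_eq_circleIntegral hf hM hτ
  have h := h.congr_of_eventuallyEq heq
  refine ⟨h.differentiableAt, fun v => ?_⟩
  rw [directionalD, h.fderiv, smul_apply,
    circleIntegral_clm_apply (hslice.circleIntegrable hR), smul_eq_mul, residueSum, ← mul_neg]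
  congr 1
  have hq : ∀ z ∈ sphere (0 : ℂ) (k * M + 1), HasDerivAt
      (fun w => evalForm k w v * (w ^ k + evalForm k w σ)⁻¹)
      (((z ^ k + evalForm k z σ) ^ 2)⁻¹ * ((z ^ k + evalForm k z σ) * evalDerivForm k z v -
      (k * z ^ (k - 1) + evalDerivForm k z σ) * evalForm k z v)) z := by
    intro z hz
    have hz0 : z ^ k + evalForm k z σ ≠ 0 := hne (σ, z) ⟨hσ, hz⟩
    refine HasDerivAt.congr_deriv
      ((hasDerivAt_evalForm_apply v z).mul ((hasDerivAt_eval_rootPoly σ z).inv hz0)) ?_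
    field_simp
    ring
  have hp := circleIntegral_mul_deriv hf hR hq ?_
  · simp only [← mul_assoc] at hp ⊢
    rw [← hp]
    refine circleIntegral.integral_congr hR fun z _ => ?_
    simp [hK'def]
    ring
  · have a1 := hc.comp (f := fun z => (σ, z)) (s := sphere (0 : ℂ) (k * M + 1)) (by fun_prop)
      fun z hz => ⟨hσ, hz⟩
    have a2 := hcd.comp (f := fun z => (σ, z)) (s := sphere (0 : ℂ) (k * M + 1)) (by fun_prop)
      fun z hz => ⟨hσ, hz⟩
    have a3 : Continuous fun z => evalForm k z v := continuous_evalForm.clm_apply continuous_const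
    have a4 : Continuous fun z => evalDerivForm k z v :=
      continuous_evalDerivForm.clm_apply continuous_const
    exact ((a1.pow 2).inv₀ fun z hz => pow_ne_zero 2 (hne (σ, z) ⟨hσ, hz⟩)).mul
      ((a1.mul a4.continuousOn).sub (a2.mul a3.continuousOn))

theorem directionalD_congr {F G : (Fin k → ℂ) → ℂ} {σ : Fin k → ℂ} (h : F =ᶠ[𝓝 σ] G)
    (v : Fin k → ℂ) : directionalD v F σ = directionalD v G σ := by
  rw [directionalD, directionalD, h.fderiv_eq]

theorem differentiable_traceFunction {f : ℂ → ℂ} (hf : Differentiable ℂ f) :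
    Differentiable ℂ (traceFunction k f) := by
  intro σ
  obtain ⟨M, hM⟩ := exists_gt ‖σ‖
  exact (hasFDerivAt_traceFunction hf ((norm_nonneg _).trans_lt hM) (by simpa using hM)).1

theorem continuousOn_mul_inv_eval_rootPoly {g : ℂ → ℂ} (hg : Continuous g) {M : ℝ}
    {σ : Fin k → ℂ} (hσ : σ ∈ ball (0 : Fin k → ℂ) M) :
    ContinuousOn (fun z => g z * (z ^ k + evalForm k z σ)⁻¹) (sphere (0 : ℂ) (k * M + 1)) := by
  have hc : Continuous fun z => z ^ k + evalForm k z σ :=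
    (continuous_pow k).add (continuous_evalForm.clm_apply continuous_const)
  exact hg.continuousOn.mul (hc.continuousOn.inv₀ fun z hz =>
    eval_rootPoly_ne_zero_of_mem (p := (σ, z)) ⟨hσ, hz⟩)

theorem eulerField_traceFunction {f : ℂ → ℂ} (hf : Differentiable ℂ f) {M : ℝ} (hM : 0 < M)
    {σ : Fin k → ℂ} (hσ : σ ∈ ball (0 : Fin k → ℂ) M) :
    eulerField (traceFunction k f) σ = residueSum k M (fun z => deriv f z * z ^ k) σ := by
  have hR : 0 ≤ k * M + 1 := by positivity
  have hd : Differentiable ℂ (deriv f) := hf.deriv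
  have h0 : (∮ z in C(0, k * M + 1), deriv f z) = 0 :=
    circleIntegral.integral_eq_zero_of_hasDerivWithinAt hR fun z _ =>
      (hf z).hasDerivAt.hasDerivWithinAt
  have hc : Continuous fun z => deriv f z * z ^ k := hd.continuous.mul (continuous_pow k)
  have hc' : Continuous fun z => deriv f z * evalForm k z σ :=
    hd.continuous.mul (continuous_evalForm.clm_apply continuous_const)
  rw [eulerField_eq_fderiv]
  change directionalD σ (traceFunction k f) σ = _
  rw [(hasFDerivAt_traceFunction hf hM hσ).2, residueSum, residueSum, ← mul_neg]
  congr 1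
  -- The two integrands add up to `f' (L_z(σ) + z^k)/P = f'`, whose integral vanishes.
  rw [neg_eq_iff_add_eq_zero, ← circleIntegral.integral_add
      ((continuousOn_mul_inv_eval_rootPoly hc' hσ).circleIntegrable hR)
      ((continuousOn_mul_inv_eval_rootPoly hc hσ).circleIntegrable hR)]
  refine Eq.trans ?_ h0
  refine circleIntegral.integral_congr hR fun z hz => ?_
  have hz0 : z ^ k + evalForm k z σ ≠ 0 := eval_rootPoly_ne_zero_of_mem (p := (σ, z)) ⟨hσ, hz⟩
  field_simp
  ring

theorem isGlobalSolution_traceFunction {f : ℂ → ℂ} (hf : Differentiable ℂ f) :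
    IsGlobalSolution (traceFunction k f) := by
  refine ⟨differentiable_traceFunction hf, fun m h2 hm σ => ?_⟩
  obtain ⟨M, hM⟩ := exists_gt ‖σ‖
  have hM0 : 0 < M := (norm_nonneg _).trans_lt hM
  have hσ : σ ∈ ball (0 : Fin k → ℂ) M := by simpa using hM
  have hnhds := isOpen_ball.mem_nhds hσ
  have hd : Continuous (deriv f) := hf.deriv.continuous
  have hL (v : Fin k → ℂ) : Continuous fun z => deriv f z * evalForm k z v :=
    hd.mul (continuous_evalForm.clm_apply continuous_const)
  have hP : Continuous fun z => deriv f z * z ^ k := hd.mul (continuous_pow k)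
  -- The first-order formulas hold with the same `M` throughout the ball, so they may be
  -- differentiated again at `σ`.
  have e1 : directionalD (coordVec k (m - 1)) (traceFunction k f) =ᶠ[𝓝 σ]
      -residueSum k M (fun z => deriv f z * evalForm k z (coordVec k (m - 1))) := by
    filter_upwards [hnhds] with τ hτ using (hasFDerivAt_traceFunction hf hM0 hτ).2 _
  have e2 : eulerField (traceFunction k f) =ᶠ[𝓝 σ] residueSum k M fun z => deriv f z * z ^ k := by
    filter_upwards [hnhds] with τ hτ using eulerField_traceFunction hf hM0 hτ
  have hneg (v : Fin k → ℂ) (G : (Fin k → ℂ) → ℂ) :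
      directionalD v (-G) σ = -directionalD v G σ := by
    simp [directionalD, fderiv_neg]
  rw [opT_eq, Pi.add_apply, directionalD_congr e1, directionalD_congr e2, hneg,
    directionalD_residueSum (hL _) hM0 hσ, directionalD_residueSum hP hM0 hσ, neg_add_eq_zero]
  congr 2
  ext z
  rw [evalForm_coordVec (by omega) (by omega), evalForm_coordVec (by omega) (by omega),
    evalForm_coordVec (by omega) (by omega)]
  -- What remains is `z^(k-m+1) z^(k-1) = z^k z^(k-m)` with equal signs; the substitutions remove
  -- truncated subtraction.
  obtain ⟨j, rfl⟩ : ∃ j, m = j + 2 := ⟨m - 2, by omega⟩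
  obtain ⟨l, rfl⟩ : ∃ l, k = l + (j + 2) := ⟨k - (j + 2), by omega⟩
  rw [show l + (j + 2) - (j + 2 - 1) = l + 1 by omega, show l + (j + 2) - 1 = l + j + 1 by omega,
    show l + (j + 2) - (j + 2) = l by omega, show j + 2 - 1 = j + 1 by omega]
  ring

/-! ### Restriction to the `σ_1`-axis and the converse -/

theorem rootPoly_smul_coordVec_one (hk : 1 ≤ k) (t : ℂ) :
    rootPoly (t • coordVec k 1) = Polynomial.X ^ (k - 1) * (Polynomial.X - Polynomial.C t) := by
  refine Polynomial.funext fun z => ?_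
  rw [eval_rootPoly, map_smul, evalForm_coordVec le_rfl hk]
  obtain ⟨j, rfl⟩ : ∃ j, k = j + 1 := ⟨k - 1, by omega⟩
  simp
  ring

theorem traceFunction_smul_coordVec_one (hk : 1 ≤ k) (f : ℂ → ℂ) (t : ℂ) :
    traceFunction k f (t • coordVec k 1) = f t + (k - 1) * f 0 := by
  rw [traceFunction, rootPoly_smul_coordVec_one hk, Polynomial.roots_mul
    (mul_ne_zero (pow_ne_zero _ Polynomial.X_ne_zero) (Polynomial.X_sub_C_ne_zero t)),
    Polynomial.roots_X_pow, Polynomial.roots_X_sub_C]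
  simp [Multiset.map_nsmul, Multiset.sum_nsmul, Nat.cast_sub hk]
  ring

theorem iterate_directionalD_smul_eq_zero {F : (Fin k → ℂ) → ℂ} (hF : Differentiable ℂ F)
    {v : Fin k → ℂ} (h : ∀ t : ℂ, F (t • v) = 0) (n : ℕ) : (directionalD v)^[n] F 0 = 0 := by
  have := congrFun (iteratedDeriv_comp_smul hF v n) 0
  simp only [h, zero_smul] at this
  rw [← this]
  simp

theorem IsGlobalSolution.exists_eq_traceFunction (hk : 1 ≤ k) {F : (Fin k → ℂ) → ℂ}
    (hF : IsGlobalSolution F) : ∃ f : ℂ → ℂ, Differentiable ℂ f ∧ F = traceFunction k f := by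
  have hk0 : (k : ℂ) ≠ 0 := by exact_mod_cast (by omega : k ≠ 0)
  -- Solves `f(t) + (k - 1) f(0) = F(t e_1)`: setting `t = 0` forces `f(0) = F(0)/k`.
  set f : ℂ → ℂ := fun t => F (t • coordVec k 1) - (k - 1) / k * F 0 with hf
  have hd := hF.1
  have hfd : Differentiable ℂ f := by fun_prop
  refine ⟨f, hfd, ?_⟩
  have hH := hF.sub (isGlobalSolution_traceFunction hfd)
  refine sub_eq_zero.1 (hH.eq_zero (iterate_directionalD_smul_eq_zero hH.1 fun t => ?_))
  rw [Pi.sub_apply, traceFunction_smul_coordVec_one hk]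
  simp only [hf, zero_smul]
  field_simp
  ring

theorem IsGlobalSolution.exists_eq_const {F : (Fin k → ℂ) → ℂ} (hF : IsGlobalSolution F)
    (h : partialD 1 F = 0) : F = fun _ => F 0 := by
  have hH := hF.sub (isGlobalSolution_const (F 0))
  have h1 : partialD 1 (F - fun _ => F 0) = 0 := by
    rw [partialD_eq_directionalD, directionalD_sub hF.1 (differentiable_const _),
      directionalD_const, sub_zero]
    exact h
  refine sub_eq_zero.1 (hH.eq_zero fun n => ?_)
  cases n with
  | zero => simp
  | succ n =>
    rw [Function.iterate_succ_apply, h1]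
    have h0 : (partialD 1)^[n] (0 : (Fin k → ℂ) → ℂ) = 0 :=
      Function.iterate_fixed (directionalD_const 0 _) n
    rw [h0, Pi.zero_apply]

end

theorem mainTheorem2 (k : ℕ) (hk : 1 ≤ k) :
    (∀ F : (Fin k → ℂ) → ℂ,
      IsGlobalSolution F ↔ ∃ f : ℂ → ℂ, Differentiable ℂ f ∧ F = traceFunction k f) ∧
    (∀ F G : (Fin k → ℂ) → ℂ, IsGlobalSolution G →
      ((IsGlobalSolution F ∧ ∀ σ : Fin k → ℂ, partialD 1 F σ = partialD 1 G σ) ↔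
        ∃ c : ℂ, ∀ σ : Fin k → ℂ, F σ = G σ + c)) := by
  refine ⟨fun F => ⟨fun hF => hF.exists_eq_traceFunction hk, ?_⟩, fun F G hG => ⟨?_, ?_⟩⟩
  · rintro ⟨f, hf, rfl⟩
    exact isGlobalSolution_traceFunction hf
  · rintro ⟨hF, h⟩
    have h1 : partialD 1 (F - G) = 0 := by
      rw [partialD_eq_directionalD, directionalD_sub hF.1 hG.1, sub_eq_zero]
      exact funext h
    refine ⟨(F - G) 0, fun σ => ?_⟩
    rw [← congrFun ((hF.sub hG).exists_eq_const h1) σ, Pi.sub_apply, add_sub_cancel]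
  · rintro ⟨c, hc⟩
    -- Written as a difference so that closure of solutions under subtraction applies.
    obtain rfl : F = G - fun _ => -c := funext fun σ => by simp [hc]
    refine ⟨hG.sub (isGlobalSolution_const (-c)), fun σ => ?_⟩
    rw [partialD_eq_directionalD, directionalD_sub hG.1 (differentiable_const _),
      directionalD_const, sub_zero]
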